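/- For a finite group $G$ (written multiplicatively), a product-one subsequence of a finite sequence $S$ of elements of $G$ is a subsequence, given by a nonempty set of indices, whose terms multiply to $1$ in some order. Let $d(G)$ be the smallest positive integer $m$ such that every sequence of $m$ elements of $G$ (repetitions allowed) has a product-one subsequence, and let $f(G)$ be the smallest positive integer $m$ such that every sequence of $d(G)$ elements of $G$ has a product-one subsequence of length at most $m$. Let $p$ be an odd prime, let $k>1$ be an integer, and let $g$ be a positive integer of multiplicative order $p$ modulo $p^k$. Let $$\mathbb{Z}_p\ltimes\mathbb{Z}_{p^k}=\mathbb{Z}_p\ltimes_g\mathbb{Z}_{p^k}=\langle x,y \mid x^{p^k}=y^p=1,\ x^g y=yx\rangle .$$ Then $$d(\mathbb{Z}_p\ltimes\mathbb{Z}_{p^k})=p^k+p-1\quad\text{and}\quad f(\mathbb{Z}_p\ltimes\mathbb{Z}_{p^k})=p^k .$$ -/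

import Mathlib

section Sequences

variable {G : Type*} [Group G]

/-- `productSet S` is `Π(S)`: the set of all products of the terms of the finite sequence `S`,
taken in any order. -/
def productSet (S : List G) : Set G :=
  {g | ∃ L : List G, L.Perm S ∧ L.prod = g}

/-- `S` is a product-one sequence: its terms multiply to `1` in some order. -/
def IsProductOne (S : List G) : Prop :=
  (1 : G) ∈ productSet S

/-- `T` is a product-one subsequence of `S`. Subsequences are given by nonempty sets of indices. -/
def IsProductOneSubseq (T S : List G) : Prop :=
  T ≠ [] ∧ T.Sublist S ∧ IsProductOne T

end Sequences

/-- The Davenport constant `d(G)`: the smallest positive integer `m` such that any sequence of `m`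
elements of `G` has a product-one subsequence. (The value is `0` only if there is no such `m`.) -/
noncomputable def davenport (G : Type*) [Group G] : ℕ :=
  sInf {m : ℕ | 0 < m ∧ ∀ S : List G, S.length = m → ∃ T : List G, IsProductOneSubseq T S}

/-- The constant `f(G)`: the smallest positive integer `m` such that any sequence of `d(G)`
elements of `G` has a product-one subsequence of length at most `m`.
(The value is `0` only if there is no such `m`.) -/
noncomputable def fConst (G : Type*) [Group G] : ℕ :=
  sInf {m : ℕ | 0 < m ∧ ∀ S : List G, S.length = davenport G →
    ∃ T : List G, IsProductOneSubseq T S ∧ T.length ≤ m}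

/-- The two generators `x`, `y` of the metacyclic group. -/
inductive MetacyclicGen
  | x
  | y

open MetacyclicGen in
/-- The relators of `⟨x, y ∣ x ^ b = y ^ a = 1, x ^ g * y = y * x⟩`. -/
def metacyclicRels (a b g : ℕ) : Set (FreeGroup MetacyclicGen) :=
  {FreeGroup.of x ^ b, FreeGroup.of y ^ a,
    FreeGroup.of x ^ g * FreeGroup.of y * (FreeGroup.of y * FreeGroup.of x)⁻¹}

/-- The metacyclic group `ℤ_a ⋉_g ℤ_b = ⟨x, y ∣ x ^ b = y ^ a = 1, x ^ g * y = y * x⟩`, to be used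
for `g` of multiplicative order `a` modulo `b`. -/
abbrev Metacyclic (a b g : ℕ) : Type :=
  PresentedGroup (metacyclicRels a b g)

/-! Write `k = m + 1`. Lifting the exponent gives `g ≡ 1` mod `p^m`, so `z = x ^ p^m` is central and
the group is a nonabelian central extension of `ℤ_{p^m} ⊕ ℤ_p` by `⟨z⟩`, of order `p`.

Upper bound (`exists_short_product_one`): zero-sum theorems in the quotient extract from `p^k + p -
1` terms `p - 1` disjoint blocks of length at most `p^m` and one more, `T`, of length less than `p^m
+ p`, all with product in `⟨z⟩`. If `T` can be shortened to length at most `p^m`, then `p` elements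
of a group of order `p` yield product one. This covers a commuting `T`, whose image lies in a proper
subgroup. Otherwise swapping two noncommuting terms of `T` gives two values in `⟨z⟩`. By
Cauchy-Davenport `p - 2` blocks with nontrivial products have at least `p - 1` subset sums, so they
cancel one of these values; the discarded block pays for the excess length of `T`.

Lower bound: `x, …, x, y, …, y` with `p - 1` terms `y`. The quotient forbids `y` in a product-one
subsequence, and `x` has order `p^k`. -/

/-! ### Zero-sum theorems in abelian `p`-groups. -/

open Finset in
/-- In an abelian group generated by three elements of orders dividing `p^a`, `p^b`, `p^c`, every
family of `p^a + p^b + p^c - 2` elements has a nonempty zero-sum subfamily (Olson). -/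
theorem exists_zero_sum_of_generators (p : ℕ) [Fact p.Prime] (a b c : ℕ) {A : Type*}
    [AddCommGroup A] (e₁ e₂ e₃ : A) (ha : p ^ a • e₁ = 0) (hb : p ^ b • e₂ = 0)
    (hc : p ^ c • e₃ = 0) (hgen : ∀ x : A, ∃ i j k : ℕ, x = i • e₁ + j • e₂ + k • e₃)
    {ι : Type*} [DecidableEq ι] (f : ι → A) (s : Finset ι)
    (hs : p ^ a + p ^ b + p ^ c ≤ s.card + 2) :
    ∃ t ⊆ s, t.Nonempty ∧ ∑ i ∈ t, f i = 0 := by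
  have hp := (Fact.out : p.Prime)
  by_contra! hcon
  let e : A → AddMonoidAlgebra (ZMod p) A := fun x => AddMonoidAlgebra.single x 1
  have e_add : ∀ x y, e (x + y) = e x * e y := fun x y => by
    simp [e, AddMonoidAlgebra.single_mul_single]
  have e_zero : e 0 = 1 := rfl
  have e_nsmul : ∀ (n : ℕ) x, e (n • x) = e x ^ n := fun n x => by
    simp [e, AddMonoidAlgebra.single_pow]
  have : CharP (AddMonoidAlgebra (ZMod p) A) p :=
    charP_of_injective_algebraMap (algebraMap (ZMod p) _).injective p
  -- Frobenius in characteristic `p`: `(1 - e x) ^ p^n = 1 - e (p^n • x)`.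
  have nil : ∀ (n : ℕ) (x : A), p ^ n • x = 0 →
      (Ideal.span {1 - e x}) ^ (p ^ n) = 0 := by
    intro n x hx
    rw [Ideal.span_singleton_pow, sub_pow_char_pow, one_pow, ← e_nsmul, hx, e_zero, sub_self]
    simp
  have mem : ∀ (n : ℕ) (x : A), 1 - e (n • x) ∈ Ideal.span {1 - e x} := by
    intro n x
    rw [e_nsmul, Ideal.mem_span_singleton]
    simpa using sub_dvd_pow_sub_pow 1 (e x) n
  have h₁ := nil a e₁ ha
  have h₂ := nil b e₂ hb
  have h₃ := nil c e₃ hc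
  set I₁ := Ideal.span {1 - e e₁}
  set I₂ := Ideal.span {1 - e e₂}
  set I₃ := Ideal.span {1 - e e₃}
  have pa : 0 < p ^ a := pow_pos hp.pos a
  have pb : 0 < p ^ b := pow_pos hp.pos b
  have pc : 0 < p ^ c := pow_pos hp.pos c
  have h₁₂ : (I₁ + I₂) ^ (p ^ a + p ^ b - 1) = 0 :=
    (Commute.all _ _).add_pow_eq_zero_of_add_le_succ_of_pow_eq_zero h₁ h₂ (by omega)
  have h₁₂₃ : (I₁ + I₂ + I₃) ^ s.card = 0 :=
    (Commute.all _ _).add_pow_eq_zero_of_add_le_succ_of_pow_eq_zero h₁₂ h₃ (by omega)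
  have hmem : ∀ x : A, 1 - e x ∈ I₁ + I₂ + I₃ := by
    intro x
    obtain ⟨i, j, k, rfl⟩ := hgen x
    have : 1 - e (i • e₁ + j • e₂ + k • e₃) = (1 - e (i • e₁)) + e (i • e₁) * (1 - e (j • e₂))
        + e (i • e₁) * e (j • e₂) * (1 - e (k • e₃)) := by
      rw [e_add, e_add]; ring
    rw [this]
    exact Submodule.add_mem_sup (Submodule.add_mem_sup (mem _ _) (Ideal.mul_mem_left _ _ (mem _ _)))
      (Ideal.mul_mem_left _ _ (mem _ _))
  have hprod : ∏ i ∈ s, (1 - e (f i)) = 0 := by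
    have : ∏ i ∈ s, (1 - e (f i)) ∈ ∏ _i ∈ s, (I₁ + I₂ + I₃) :=
      Ideal.prod_mem_prod fun i _ => hmem (f i)
    rw [prod_const, h₁₂₃] at this
    simpa using this
  have e_sum : ∀ t : Finset ι, ∏ i ∈ t, e (f i) = e (∑ i ∈ t, f i) := by
    intro t
    induction t using Finset.induction_on with
    | empty => simp [e_zero]
    | insert i t hi ih => rw [prod_insert hi, sum_insert hi, e_add, ih]
  have hexp : ∏ i ∈ s, (1 - e (f i)) = ∑ t ∈ s.powerset, (-1) ^ t.card * e (∑ i ∈ t, f i) := by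
    simp_rw [sub_eq_add_neg]
    rw [Finset.prod_one_add]
    exact sum_congr rfl fun t _ => by rw [Finset.prod_neg, e_sum]
  -- With no nonempty zero-sum subfamily, only `t = ∅` contributes to the coefficient at `0`, so the
  -- vanishing product would have coefficient `1` there.
  have hcoef : ∀ t ∈ s.powerset,
      ((-1 : AddMonoidAlgebra (ZMod p) A) ^ t.card * e (∑ i ∈ t, f i)).coeff 0 =
        if t = ∅ then 1 else 0 := by
    intro t ht
    split_ifs with h
    · subst h
      simp [e_zero]
    · have := hcon t (mem_powerset.1 ht) (nonempty_iff_ne_empty.2 h)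
      rcases neg_one_pow_eq_or (AddMonoidAlgebra (ZMod p) A) t.card with h' | h' <;>
        simp [h', e, this]
  have hone : (∏ i ∈ s, (1 - e (f i))).coeff 0 = 1 := by
    rw [hexp, AddMonoidAlgebra.coeff_sum, Finsupp.finsetSum_apply, sum_congr rfl hcoef]
    simp
  rw [hprod] at hone
  simp at hone

/-- The Davenport constant of `ℤ_{p^a} ⊕ ℤ_{p^b} ⊕ ℤ_{p^c}` is at most `p^a + p^b + p^c - 2`. -/
theorem exists_zero_sum_zmod_prod (p : ℕ) [Fact p.Prime] (a b c : ℕ) {ι : Type*} [DecidableEq ι]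
    (f : ι → ZMod (p ^ a) × ZMod (p ^ b) × ZMod (p ^ c)) (s : Finset ι)
    (hs : p ^ a + p ^ b + p ^ c ≤ s.card + 2) :
    ∃ t ⊆ s, t.Nonempty ∧ ∑ i ∈ t, f i = 0 := by
  have : ∀ n : ℕ, NeZero (p ^ n) := fun n => ⟨pow_ne_zero n (Fact.out : p.Prime).ne_zero⟩
  refine exists_zero_sum_of_generators p a b c (1, 0, 0) (0, 1, 0) (0, 0, 1) ?_ ?_ ?_ ?_ f s hs
  · simp
  · simp
  · simp
  · rintro ⟨x, y, z⟩
    exact ⟨x.val, y.val, z.val, by simp⟩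

open Finset in
/-- The Davenport constant of `ℤ_{p^a} ⊕ ℤ_{p^b}` is at most `p^a + p^b - 1`. -/
theorem exists_zero_sum_zmod_prod_two (p : ℕ) [Fact p.Prime] (a b : ℕ) {ι : Type*} [DecidableEq ι]
    (f : ι → ZMod (p ^ a) × ZMod (p ^ b)) (s : Finset ι)
    (hs : p ^ a + p ^ b ≤ s.card + 1) :
    ∃ t ⊆ s, t.Nonempty ∧ ∑ i ∈ t, f i = 0 := by
  obtain ⟨t, ht, hne, h⟩ := exists_zero_sum_zmod_prod p a b 0
    (fun i => ((f i).1, (f i).2, 0)) s (by rw [pow_zero]; omega)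
  refine ⟨t, ht, hne, ?_⟩
  simp only [Prod.ext_iff, Prod.fst_sum, Prod.snd_sum, Prod.fst_zero, Prod.snd_zero] at h ⊢
  exact ⟨h.1, h.2.1⟩

open Finset in
/-- Every family of `p^a + 2 p^b - 2` elements of `ℤ_{p^a} ⊕ ℤ_{p^b}`, `b ≤ a`, has a nonempty
zero-sum subfamily of size at most `p^a`. -/
theorem exists_short_zero_sum_zmod_prod (p : ℕ) [Fact p.Prime] (a b : ℕ) (hab : b ≤ a)
    {ι : Type*} [DecidableEq ι]
    (f : ι → ZMod (p ^ a) × ZMod (p ^ b)) (s : Finset ι)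
    (hs : p ^ a + 2 * p ^ b ≤ s.card + 2) :
    ∃ t ⊆ s, t.Nonempty ∧ ∑ i ∈ t, f i = 0 ∧ t.card ≤ p ^ a := by
  have hp := (Fact.out : p.Prime)
  have hle : p ^ b ≤ p ^ a := Nat.pow_le_pow_right hp.pos hab
  have pb : 0 < p ^ b := pow_pos hp.pos b
  obtain ⟨s', hs's, hs'⟩ := exists_subset_card_eq
    (show p ^ a + 2 * p ^ b - 2 ≤ s.card by omega)
  -- The third coordinate counts terms, forcing `p^a` to divide the size of a zero-sum subfamily.
  -- The `p^a - p^b` padding terms bring the total to `2p^a + p^b - 2`, exactly the rank-three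
  -- bound.
  let F : ι ⊕ Fin (p ^ a - p ^ b) → ZMod (p ^ a) × ZMod (p ^ b) × ZMod (p ^ a) :=
    Sum.elim (fun i => ((f i).1, (f i).2, 1)) (fun _ => (0, 0, 1))
  obtain ⟨t, ht, hne, h⟩ := exists_zero_sum_zmod_prod p a b a F (s'.disjSum univ) (by
    simp only [card_disjSum, card_univ, Fintype.card_fin]; omega)
  have hcard := card_toLeft_add_card_toRight (u := t)
  have hR : t.toRight.card ≤ p ^ a - p ^ b := by
    simpa using card_le_univ t.toRight
  have hLs : t.toLeft ⊆ s' := fun i hi => by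
    simpa using ht (mem_toLeft.1 hi)
  have hL : t.toLeft.card ≤ p ^ a + 2 * p ^ b - 2 := hs' ▸ card_le_card hLs
  rw [← toLeft_disjSum_toRight (u := t), sum_disjSum] at h
  simp only [F, Sum.elim_inl, Sum.elim_inr, Prod.ext_iff, Prod.fst_add, Prod.snd_add, Prod.fst_sum,
    Prod.snd_sum, Prod.fst_zero, Prod.snd_zero, add_zero, sum_const, Prod.smul_mk, smul_zero, nsmul_one]
    at h
  obtain ⟨h1, h2, h3⟩ := h
  rw [← Nat.cast_add, ZMod.natCast_eq_zero_iff, hcard] at h3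
  have hsum : ∑ i ∈ t.toLeft, f i = 0 := by
    simp only [Prod.ext_iff, Prod.fst_sum, Prod.snd_sum, Prod.fst_zero, Prod.snd_zero]
    exact ⟨h1, h2⟩
  have hpos : 0 < t.card := hne.card_pos
  obtain ⟨q, hq⟩ := h3
  have hq2 : q < 3 := by
    by_contra! hq3
    have : p ^ a * 3 ≤ p ^ a * q := Nat.mul_le_mul_left _ hq3
    omega
  by_cases hsmall : t.toLeft.card ≤ p ^ a
  · exact ⟨t.toLeft, hLs.trans hs's, card_pos.1 (by
      rcases Nat.eq_zero_or_pos q with rfl | hq0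
      · omega
      have : p ^ a * 1 ≤ p ^ a * q := Nat.mul_le_mul_left _ hq0
      omega), hsum, hsmall⟩
  obtain rfl : q = 2 := by
    interval_cases q <;> omega
  -- Now `t` has `2p^a` terms, so at least `p^a + p^b` are genuine. Setting one aside makes the
  -- zero-sum part `u` proper; `u` or its complement has at most `p^a` terms.
  obtain ⟨i, hi⟩ : t.toLeft.Nonempty := card_pos.1 (by omega)
  obtain ⟨u, hu, hune, husum⟩ := exists_zero_sum_zmod_prod_two p a b f (t.toLeft.erase i) (by
    rw [card_erase_of_mem hi]; omega)
  have hut : u ⊆ t.toLeft := hu.trans (erase_subset _ _)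
  have hc := card_sdiff_add_card_eq_card hut
  by_cases hus : u.card ≤ p ^ a
  · exact ⟨u, (hut.trans hLs).trans hs's, hune, husum, hus⟩
  · refine ⟨t.toLeft \ u, (sdiff_subset.trans hLs).trans hs's,
      ⟨i, mem_sdiff.2 ⟨hi, fun h => by simpa using hu h⟩⟩, ?_, by omega⟩
    have := sum_sdiff (f := f) hut
    rwa [husum, add_zero, hsum] at this

/-! ### Transfer to multisets, pigeonhole and subset sums. -/

/-- Transfer of a statement on subfamilies of finite families to multisets. -/
theorem Multiset.exists_le_of_finset {α M : Type*} [AddCommMonoid M] (f : α → M) (n : ℕ)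
    (P : ℕ → Prop)
    (h : ∀ (F : α × ℕ → M) (s : Finset (α × ℕ)), n ≤ s.card →
      ∃ t ⊆ s, t.Nonempty ∧ ∑ i ∈ t, F i = 0 ∧ P t.card)
    (S : Multiset α) (hS : n ≤ S.card) :
    ∃ T ≤ S, T ≠ 0 ∧ (T.map f).sum = 0 ∧ P T.card := by
  classical
  obtain ⟨t, hts, hne, hsum, hP⟩ := h (fun i => f i.1) S.toEnumFinset (by simpa using hS)
  refine ⟨t.val.map Prod.fst, ?_, ?_, ?_, ?_⟩
  · conv_rhs => rw [← S.map_toEnumFinset_fst]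
    exact Multiset.map_le_map (Finset.val_le_iff.2 hts)
  · simpa [Finset.nonempty_iff_ne_empty] using hne
  · rw [Multiset.map_map]; exact hsum
  · simpa using hP

/-- A list of at least `|H|` elements of a finite group `H` contains a nonempty product-one sublist
of length at most `|H|`. -/
theorem List.exists_sublist_prod_eq_one {α Q : Type*} [Group Q] (f : α → Q) (H : Subgroup Q)
    [Finite H] (l : List α) (hl : ∀ a ∈ l, f a ∈ H) (hcard : Nat.card H ≤ l.length) :
    ∃ t : List α, t ≠ [] ∧ t.Sublist l ∧ t.length ≤ Nat.card H ∧ (t.map f).prod = 1 := by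
  -- Two of the `|H| + 1` prefix products coincide; the segment between them has product one.
  let P : Fin (Nat.card H + 1) → H := fun i => ⟨((l.take i).map f).prod, by
    refine H.list_prod_mem fun x hx => ?_
    obtain ⟨a, ha, rfl⟩ := List.mem_map.1 hx
    exact hl a (List.mem_of_mem_take ha)⟩
  have hP : ¬ Function.Injective P := fun h => by
    have := Nat.card_le_card_of_injective P h
    simp at this
  simp only [Function.Injective, not_forall] at hP
  obtain ⟨i, j, hij, hne⟩ := hP
  wlog hlt : i < j generalizing i j
  · exact this j i hij.symm (Ne.symm hne) (lt_of_le_of_ne (not_lt.1 hlt) (Ne.symm hne))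
  have hlt' : (i : ℕ) < j := hlt
  have hj := j.isLt
  refine ⟨(l.take j).drop i, ?_, (List.drop_sublist _ _).trans (List.take_sublist _ _), ?_, ?_⟩
  · rw [← List.length_pos_iff_ne_nil, List.length_drop, List.length_take]
    omega
  · rw [List.length_drop, List.length_take]
    omega
  · have h1 : ((l.take i).map f).prod = ((l.take j).map f).prod := congrArg Subtype.val hij
    rw [← List.take_append_drop i (l.take j), List.take_take, min_eq_left hlt'.le, List.map_append,
      List.prod_append] at h1
    exact left_eq_mul.1 h1

open Pointwise in
/-- `n` nonzero elements of `ℤ_p` have at least `min p (n + 1)` subset sums. -/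
theorem ZMod.exists_finset_sublist_sums {p : ℕ} (hp : p.Prime) {α : Type*} (c : α → ZMod p)
    (l : List α) (hl : ∀ a ∈ l, c a ≠ 0) :
    ∃ F : Finset (ZMod p), min p (l.length + 1) ≤ F.card ∧
      ∀ s ∈ F, ∃ t : List α, t.Sublist l ∧ (t.map c).sum = s := by
  induction l with
  | nil =>
    exact ⟨{0}, by simp, fun s hs =>
      ⟨[], by simp, by simpa using (Finset.mem_singleton.1 hs).symm⟩⟩
  | cons a l ih =>
    obtain ⟨F, hF, hs⟩ := ih fun b hb => hl b (List.mem_cons_of_mem _ hb)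
    have hpos := hp.pos
    have hne : F.Nonempty := Finset.card_pos.1 (by omega)
    have hca : ({0, c a} : Finset (ZMod p)).card = 2 :=
      Finset.card_pair (hl a List.mem_cons_self).symm
    refine ⟨{0, c a} + F, ?_, ?_⟩
    · have := ZMod.cauchy_davenport hp (Finset.insert_nonempty 0 {c a}) hne
      rw [hca] at this
      rw [List.length_cons]
      omega
    · intro s hsF
      obtain ⟨x, hx, y, hy, rfl⟩ := Finset.mem_add.1 hsF
      obtain ⟨t, ht, rfl⟩ := hs y hy
      rcases Finset.mem_insert.1 hx with rfl | hx
      · exact ⟨t, ht.cons a, by simp⟩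
      · exact ⟨a :: t, ht.cons_cons a, by simp [Finset.mem_singleton.1 hx]⟩

/-! ### Product-one subsequences in central extensions. -/

section CentralExtension

variable {G : Type*} [Group G] {p m : ℕ}

theorem exists_list_short_of_card [Fact p.Prime] (hm : 1 ≤ m)
    (φ : G →* Multiplicative (ZMod (p ^ m) × ZMod (p ^ 1)))
    (S : Multiset G) (hS : p ^ m + 2 * p ≤ S.card + 2) :
    ∃ B : List G, B ≠ [] ∧ (B : Multiset G) ≤ S ∧ φ B.prod = 1 ∧ B.length ≤ p ^ m := by
  classical
  obtain ⟨T, hT, hne, hsum, hcard⟩ := Multiset.exists_le_of_finset (fun x => (φ x).toAdd)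
    (p ^ m + 2 * p - 2) (· ≤ p ^ m)
    (fun F s hs => exists_short_zero_sum_zmod_prod p m 1 hm F s (by rw [pow_one]; omega))
    S (by omega)
  refine ⟨T.toList, by simpa using hne, by simpa using hT, ?_, by simpa using hcard⟩
  rw [map_list_prod]
  have := congrArg Multiplicative.ofAdd hsum
  rw [← T.coe_toList, Multiset.map_coe, Multiset.sum_coe, ofAdd_list_prod, List.map_map] at this
  simpa [Function.comp_def] using this

theorem exists_list_of_card [Fact p.Prime]
    (φ : G →* Multiplicative (ZMod (p ^ m) × ZMod (p ^ 1)))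
    (S : Multiset G) (hS : p ^ m + p ≤ S.card + 1) :
    ∃ B : List G, B ≠ [] ∧ (B : Multiset G) ≤ S ∧ φ B.prod = 1 ∧ B.length < p ^ m + p := by
  classical
  have hp := (Fact.out : p.Prime).pos
  obtain ⟨S', hS', hc⟩ : ∃ S' ≤ S, S'.card = p ^ m + p - 1 :=
    ⟨(S.toList.take (p ^ m + p - 1) : List G),
      by conv_rhs => rw [← S.coe_toList]
         exact Multiset.coe_le.2 (List.take_sublist _ _).subperm, by simp; omega⟩
  obtain ⟨T, hT, hne, hsum, -⟩ := Multiset.exists_le_of_finset (fun x => (φ x).toAdd)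
    (p ^ m + p - 1) (fun _ => True)
    (fun F s hs => by
      obtain ⟨t, h1, h2, h3⟩ := exists_zero_sum_zmod_prod_two p m 1 F s (by rw [pow_one]; omega)
      exact ⟨t, h1, h2, h3, trivial⟩)
    S' (by omega)
  have hcard := Multiset.card_le_card hT
  refine ⟨T.toList, by simpa using hne, by simpa using hT.trans hS', ?_, by simp; omega⟩
  rw [map_list_prod]
  have := congrArg Multiplicative.ofAdd hsum
  rw [← T.coe_toList, Multiset.map_coe, Multiset.sum_coe, ofAdd_list_prod, List.map_map] at this
  simpa [Function.comp_def] using this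

/-- Disjoint short subsequences with products in the kernel. -/
theorem exists_blocks [Fact p.Prime] (hm : 1 ≤ m)
    (φ : G →* Multiplicative (ZMod (p ^ m) × ZMod (p ^ 1))) (j : ℕ)
    (S : Multiset G) (hS : j * p ^ m + 2 * p ≤ S.card + 2) :
    ∃ Bs : List (List G), Bs.length = j ∧ (Bs.flatten : Multiset G) ≤ S ∧
      ∀ B ∈ Bs, B ≠ [] ∧ φ B.prod = 1 ∧ B.length ≤ p ^ m := by
  classical
  induction j generalizing S with
  | zero => exact ⟨[], rfl, by simp, by simp⟩
  | succ j ih =>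
    rw [Nat.succ_mul] at hS
    obtain ⟨B, hne, hle, hφ, hlen⟩ := exists_list_short_of_card hm φ S
      (by have := Nat.zero_le (j * p ^ m); omega)
    have hc : (S - (B : Multiset G)).card = S.card - B.length := by
      rw [Multiset.card_sub hle, Multiset.coe_card]
    obtain ⟨Bs, h1, h2, h3⟩ := ih (S - (B : Multiset G)) (by omega)
    refine ⟨B :: Bs, by simp [h1], ?_, ?_⟩
    · rw [List.flatten_cons, ← Multiset.coe_add, add_comm]
      exact add_le_of_le_tsub_right_of_le hle h2
    · intro C hC
      rcases List.mem_cons.1 hC with rfl | hC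
      · exact ⟨hne, hφ, hlen⟩
      · exact h3 C hC

/-- A pairwise commuting list has a short sublist with product in the kernel: its image in
`ℤ_{p^m} ⊕ ℤ_p` lies in a proper subgroup, of order at most `p^m`. -/
theorem exists_sublist_of_commute [Fact p.Prime]
    (φ : G →* Multiplicative (ZMod (p ^ m) × ZMod (p ^ 1))) (hker : φ.ker ≤ Subgroup.center G)
    (hG : ∃ u v : G, u * v ≠ v * u) (l : List G) (hl : ∀ u ∈ l, ∀ v ∈ l, u * v = v * u)
    (hlen : p ^ m ≤ l.length) :
    ∃ t : List G, t ≠ [] ∧ t.Sublist l ∧ φ t.prod = 1 ∧ t.length ≤ p ^ m := by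
  have hp := (Fact.out : p.Prime)
  have : ∀ n : ℕ, NeZero (p ^ n) := fun n => ⟨pow_ne_zero n hp.ne_zero⟩
  -- With the central kernel adjoined, a surjective image would make the commutative group generated
  -- by `X` all of `G`.
  let X : Set G := {u | u ∈ l} ∪ φ.ker
  have hX : ∀ u ∈ X, ∀ v ∈ X, u * v = v * u := by
    rintro u (hu | hu) v (hv | hv)
    · exact hl u hu v hv
    · exact Subgroup.mem_center_iff.1 (hker hv) u
    · exact (Subgroup.mem_center_iff.1 (hker hu) v).symm
    · exact (Subgroup.mem_center_iff.1 (hker hu) v).symm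
  let H₀ := Subgroup.closure X
  have h1 : H₀ ≤ Subgroup.centralizer X := (Subgroup.closure_le _).2 fun u hu =>
    Subgroup.mem_centralizer_iff.2 fun v hv => hX v hv u hu
  have h2 : H₀ ≤ Subgroup.centralizer H₀ := (Subgroup.closure_le _).2 fun u hu =>
    Subgroup.mem_centralizer_iff.2 fun v hv => (Subgroup.mem_centralizer_iff.1 (h1 hv) u hu).symm
  let H := H₀.map φ
  have htop : H ≠ ⊤ := by
    intro htop
    have hmem : ∀ u : G, u ∈ H₀ := by
      intro u
      obtain ⟨h, hh, hφ⟩ : φ u ∈ H := htop ▸ Subgroup.mem_top _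
      have : u * h⁻¹ ∈ H₀ := Subgroup.subset_closure (Or.inr (by
        simp [MonoidHom.mem_ker, hφ]))
      simpa using H₀.mul_mem this hh
    obtain ⟨u, v, huv⟩ := hG
    exact huv (Subgroup.mem_centralizer_iff.1 (h2 (hmem v)) u (hmem u))
  have hQ : Nat.card (Multiplicative (ZMod (p ^ m) × ZMod (p ^ 1))) = p ^ (m + 1) := by
    rw [Nat.card_congr Multiplicative.toAdd, Nat.card_prod, Nat.card_zmod, Nat.card_zmod, ← pow_add]
  have hH : Nat.card H ≤ p ^ m := by
    have hdvd := H.card_subgroup_dvd_card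
    rw [hQ] at hdvd
    obtain ⟨i, hi, hc⟩ := (Nat.dvd_prime_pow hp).1 hdvd
    rcases Nat.lt_or_ge i (m + 1) with hi' | hi'
    · rw [hc]; exact Nat.pow_le_pow_right hp.pos (by omega)
    · exact absurd (H.eq_top_of_card_eq (by rw [hQ, hc, le_antisymm hi hi'])) htop
  obtain ⟨t, h1, h2, h3, h4⟩ := List.exists_sublist_prod_eq_one φ H l
    (fun a ha => Subgroup.mem_map_of_mem φ (Subgroup.subset_closure (Or.inl ha))) (hH.trans hlen)
  exact ⟨t, h1, h2, by rw [map_list_prod, h4], h3.trans hH⟩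

theorem List.length_flatten_le {α : Type*} (Bs : List (List α)) (n : ℕ)
    (h : ∀ B ∈ Bs, B.length ≤ n) : Bs.flatten.length ≤ Bs.length * n := by
  rw [List.length_flatten]
  simpa using List.sum_le_card_nsmul (Bs.map List.length) n (by simpa using h)

theorem List.prod_flatten_eq_pow {z : G} (N : List G → ℕ) (Bs : List (List G))
    (h : ∀ B ∈ Bs, B.prod = z ^ N B) : Bs.flatten.prod = z ^ (Bs.map N).sum := by
  induction Bs with
  | nil => simp
  | cons B Bs ih =>
    rw [List.flatten_cons, List.prod_append, ih fun C hC => h C (List.mem_cons_of_mem _ hC),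
      h B List.mem_cons_self, List.map_cons, List.sum_cons, pow_add]

/-- A nonabelian central extension of `ℤ_{p^m} ⊕ ℤ_p` by a group of order `p`: every sequence of
length `p^{m+1} + p - 1` has a product-one subsequence of length at most `p^{m+1}`. -/
theorem exists_short_product_one [Fact p.Prime] (hp2 : 2 < p) (hm : 1 ≤ m)
    (φ : G →* Multiplicative (ZMod (p ^ m) × ZMod (p ^ 1))) (hker : φ.ker ≤ Subgroup.center G)
    (hG : ∃ u v : G, u * v ≠ v * u) (z : G) (hz : z ^ p = 1)
    (hzker : ∀ u, φ u = 1 → ∃ n : ℕ, u = z ^ n)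
    (S : Multiset G) (hS : S.card = p ^ (m + 1) + p - 1) :
    ∃ L : List G, L ≠ [] ∧ (L : Multiset G) ≤ S ∧ L.prod = 1 ∧ L.length ≤ p ^ (m + 1) := by
  classical
  have hp := (Fact.out : p.Prime)
  have hpm : p ≤ p ^ m := Nat.le_self_pow (by omega) p
  obtain ⟨q, rfl⟩ : ∃ q, p = q + 2 := ⟨p - 2, by omega⟩
  obtain ⟨P, hP⟩ : ∃ P, (q + 2) ^ m = P := ⟨_, rfl⟩
  rw [hP] at hpm
  have hpow : (q + 2) ^ (m + 1) = (q + 1) * P + P := by rw [pow_succ, hP]; ring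
  rw [hpow] at hS ⊢
  obtain ⟨Bs, hBlen, hBle, hB⟩ := exists_blocks hm φ (q + 1) S (by rw [hP]; omega)
  have hBcard : Bs.flatten.length ≤ (q + 1) * P :=
    hBlen ▸ List.length_flatten_le Bs P fun B h => hP ▸ (hB B h).2.2
  have hc : (S - (Bs.flatten : Multiset G)).card = S.card - Bs.flatten.length := by
    rw [Multiset.card_sub hBle, Multiset.coe_card]
  obtain ⟨T, hTne, hTle, hTφ, hTlen⟩ := exists_list_of_card φ (S - (Bs.flatten : Multiset G))
    (by rw [hP]; omega)
  rw [hP] at hTlen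
  have hTB : ∀ T' : List G, (T' : Multiset G) ≤ T → ∀ Ts : List (List G), Ts.Sublist Bs →
      ((T' ++ Ts.flatten : List G) : Multiset G) ≤ S := by
    intro T' hT' Ts hTs
    rw [← Multiset.coe_add]
    exact (add_le_add (hT'.trans hTle) (Multiset.coe_le.2 hTs.flatten.subperm)).trans
      (tsub_add_cancel_of_le hBle).le
  -- The block `T'` and the `p - 1` others have products in `⟨z⟩`, of order at most `p`, and total
  -- length at most `p * P`.
  have finish : ∀ T' : List G, T' ≠ [] → (T' : Multiset G) ≤ T → φ T'.prod = 1 → T'.length ≤ P →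
      ∃ L : List G, L ≠ [] ∧ (L : Multiset G) ≤ S ∧ L.prod = 1 ∧ L.length ≤ (q + 1) * P + P := by
    intro T' hne hle hφ hlen
    have : Finite (Subgroup.zpowers z) :=
      Set.finite_coe_iff.2 (isOfFinOrder_iff_pow_eq_one.2 ⟨q + 2, by omega, hz⟩).finite_zpowers
    have hzc : Nat.card (Subgroup.zpowers z) ≤ q + 2 := by
      rw [Nat.card_zpowers]
      exact orderOf_le_of_pow_eq_one (by omega) hz
    obtain ⟨Ts, h1, h2, -, h4⟩ := List.exists_sublist_prod_eq_one List.prod (Subgroup.zpowers z)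
      (T' :: Bs) (by
        intro B hB'
        have : φ B.prod = 1 := by
          rcases List.mem_cons.1 hB' with rfl | hB'
          · exact hφ
          · exact (hB B hB').2.1
        obtain ⟨n, hn⟩ := hzker _ this
        exact hn ▸ Subgroup.npow_mem_zpowers z n) (by rw [List.length_cons, hBlen]; omega)
    refine ⟨Ts.flatten, ?_, ?_, by rw [List.prod_flatten, h4], ?_⟩
    · obtain ⟨B, hBT⟩ := List.exists_mem_of_ne_nil Ts h1
      have : B ≠ [] := by
        rcases List.mem_cons.1 (h2.subset hBT) with rfl | hB'
        · exact hne
        · exact (hB B hB').1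
      exact fun h => this (List.flatten_eq_nil_iff.1 h B hBT)
    · exact (Multiset.coe_le.2 h2.flatten.subperm).trans (hTB T' hle Bs (List.Sublist.refl _))
    · refine h2.flatten.length_le.trans ?_
      rw [List.flatten_cons, List.length_append]
      omega
  by_cases hTP : T.length ≤ P
  · exact finish T hTne le_rfl hTφ hTP
  by_cases hcomm : ∀ u ∈ T, ∀ v ∈ T, u * v = v * u
  · obtain ⟨T', h1, h2, h3, h4⟩ := exists_sublist_of_commute φ hker hG T hcomm (by rw [hP]; omega)
    exact finish T' h1 (Multiset.coe_le.2 h2.subperm) h3 (hP ▸ h4)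
  push Not at hcomm
  obtain ⟨u, hu, v, hv, huv⟩ := hcomm
  have hvu : v ≠ u := fun h => huv (by rw [h])
  obtain ⟨r, hr⟩ : ∃ r, T.Perm (u :: v :: r) :=
    ⟨(T.erase u).erase v, (List.perm_cons_erase hu).trans
      ((List.perm_cons_erase ((List.mem_erase_of_ne hvu).2 hv)).cons u)⟩
  have hφperm : ∀ T' : List G, T.Perm T' → φ T'.prod = 1 := by
    intro T' h
    rw [← hTφ, map_list_prod, map_list_prod]
    exact ((h.map φ).prod_eq).symm
  have hr' : T.Perm (v :: u :: r) := hr.trans (List.Perm.swap _ _ _)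
  obtain ⟨n₁, hn₁⟩ := hzker _ (hφperm _ hr)
  obtain ⟨n₂, hn₂⟩ := hzker _ (hφperm _ hr')
  have hzpow : ∀ n : ℕ, (n : ZMod (q + 2)) = 0 → z ^ n = 1 := by
    intro n hn
    obtain ⟨k, rfl⟩ := (ZMod.natCast_eq_zero_iff _ _).1 hn
    rw [pow_mul, hz, one_pow]
  -- Equal exponents would give `u * v = v * u` after cancelling the common tail `r`.
  have hn : (n₁ : ZMod (q + 2)) ≠ n₂ := by
    intro h
    have h1 : z ^ n₁ = z ^ n₂ := pow_eq_pow_iff_modEq.2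
      (((ZMod.natCast_eq_natCast_iff _ _ _).1 h).of_dvd (orderOf_dvd_of_pow_eq_one hz))
    rw [← hn₁, ← hn₂, List.prod_cons, List.prod_cons, List.prod_cons, List.prod_cons, ← mul_assoc,
      ← mul_assoc] at h1
    exact huv (mul_right_cancel h1)
  choose! N hN using fun B (h : B ∈ Bs) => hzker _ (hB B h).2.1
  by_cases hzero : ∃ B ∈ Bs, (N B : ZMod (q + 2)) = 0
  · obtain ⟨B, hBm, hB0⟩ := hzero
    refine ⟨B, (hB B hBm).1, ?_, ?_, ?_⟩
    · have := hTB [] (by simp) [B] (List.singleton_sublist.2 hBm)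
      simpa using this
    · rw [hN B hBm, hzpow _ hB0]
    · exact (hP ▸ (hB B hBm).2.2).trans (Nat.le_add_left _ _)
  push Not at hzero
  -- Keeping `q = p - 2` blocks leaves room for `T`: `q * P + (P + p - 1) ≤ p * P` because `p ≤ P`.
  have hsub : (Bs.drop 1).Sublist Bs := List.drop_sublist _ _
  obtain ⟨F, hF, hFs⟩ := ZMod.exists_finset_sublist_sums hp (fun B => (N B : ZMod (q + 2)))
    (Bs.drop 1) fun B h => hzero B (hsub.subset h)
  rw [List.length_drop, hBlen] at hF
  -- `F` misses at most one residue, while `-n₁` and `-n₂` are distinct.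
  have hit : ∃ T' : List G, T.Perm T' ∧ ∃ n : ℕ, T'.prod = z ^ n ∧ -(n : ZMod (q + 2)) ∈ F := by
    by_contra! hcon
    have h1 := hcon _ hr n₁ hn₁
    have h2 := hcon _ hr' n₂ hn₂
    have hle : F ⊆ Finset.univ \ {-(n₁ : ZMod (q + 2)), -(n₂ : ZMod (q + 2))} := by
      intro s hs
      simp only [Finset.mem_sdiff, Finset.mem_univ, true_and, Finset.mem_insert,
        Finset.mem_singleton, not_or]
      exact ⟨fun h => h1 (h ▸ hs), fun h => h2 (h ▸ hs)⟩
    have := Finset.card_le_card hle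
    rw [Finset.card_sdiff_of_subset (Finset.subset_univ _), Finset.card_pair (by simpa using hn),
      Finset.card_univ, ZMod.card] at this
    omega
  obtain ⟨T', hTT', n, hn', hnF⟩ := hit
  obtain ⟨Ts, hTs, hsum⟩ := hFs _ hnF
  have hTsB := hTs.trans hsub
  have hlen : Ts.length ≤ q := by
    have := hTs.length_le
    rw [List.length_drop, hBlen] at this
    omega
  refine ⟨T' ++ Ts.flatten, ?_, hTB T' (Multiset.coe_eq_coe.2 hTT'.symm).le Ts hTsB, ?_, ?_⟩
  · intro h
    have h' := (List.append_eq_nil_iff.1 h).1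
    subst h'
    exact hTne hTT'.eq_nil
  · rw [List.prod_append, hn', List.prod_flatten_eq_pow N Ts fun B h => hN B (hTsB.subset h),
      ← pow_add]
    apply hzpow
    rw [Nat.cast_add, Nat.cast_list_sum, List.map_map]
    simp only [Function.comp_def]
    rw [hsum, add_neg_cancel]
  · have h1 := List.length_flatten_le Ts P fun B h => hP ▸ (hB B (hTsB.subset h)).2.2
    have h2 : Ts.length * P ≤ q * P := Nat.mul_le_mul_right P hlen
    rw [List.length_append, ← hTT'.length_eq]
    have h3 : (q + 1) * P = q * P + P := by ring
    omega

end CentralExtension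

/-! ### The structure of the metacyclic group. -/

/-- Fermat gives `g ≡ 1` mod `p`; lifting the exponent for odd `p` then gives `v_p(g^p - 1) = v_p(g
- 1) + 1`. -/
theorem pow_dvd_sub_one_of_orderOf_eq {p m g : ℕ} (hp : p.Prime) (hodd : Odd p)
    (hg : orderOf (g : ZMod (p ^ (m + 1))) = p) : (p ^ m : ℤ) ∣ (g : ℤ) - 1 := by
  have := Fact.mk hp
  have h1 : ((g : ℤ) : ZMod (p ^ (m + 1))) ^ p = 1 := by
    have := pow_orderOf_eq_one (g : ZMod (p ^ (m + 1)))
    rw [hg] at this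
    simpa using this
  have h2 : ((p : ℤ) ^ (m + 1)) ∣ (g : ℤ) ^ p - 1 ^ p := by
    have : (((g : ℤ) ^ p - 1 ^ p : ℤ) : ZMod (p ^ (m + 1))) = 0 := by
      push_cast at h1 ⊢
      rw [h1, one_pow, sub_self]
    exact_mod_cast (ZMod.intCast_zmod_eq_zero_iff_dvd _ _).1 this
  have h3 : (p : ℤ) ∣ (g : ℤ) - 1 := by
    have h : (p : ℤ) ∣ (g : ℤ) ^ p - 1 ^ p := (dvd_pow_self _ (Nat.succ_ne_zero m)).trans h2
    rw [← ZMod.intCast_zmod_eq_zero_iff_dvd] at h ⊢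
    push_cast at h ⊢
    rwa [ZMod.pow_card, one_pow] at h
  have h4 : ¬ (p : ℤ) ∣ (g : ℤ) := fun h => by
    have := dvd_sub h h3
    rw [sub_sub_cancel] at this
    exact hp.one_lt.ne' (by exact_mod_cast Int.eq_one_of_dvd_one (by positivity) this)
  have h5 := Int.emultiplicity_pow_sub_pow hp hodd h3 h4 p
  rw [pow_dvd_iff_le_emultiplicity, h5, (Nat.finiteMultiplicity_iff.2
    ⟨hp.ne_one, hp.pos⟩).emultiplicity_self] at h2
  rw [pow_dvd_iff_le_emultiplicity]
  push_cast at h2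
  exact (ENat.add_le_add_iff_right ENat.one_ne_top).1 h2

namespace Metacyclic

open MetacyclicGen

variable {p m g : ℕ}

/-- The generator `x` of the metacyclic group. -/
def x (a b g : ℕ) : Metacyclic a b g := PresentedGroup.of MetacyclicGen.x

/-- The generator `y` of the metacyclic group. -/
def y (a b g : ℕ) : Metacyclic a b g := PresentedGroup.of MetacyclicGen.y

theorem x_pow (a b g : ℕ) : x a b g ^ b = 1 :=
  PresentedGroup.one_of_mem (rels := metacyclicRels a b g)
    (x := FreeGroup.of MetacyclicGen.x ^ b) (by simp [metacyclicRels])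

theorem y_pow (a b g : ℕ) : y a b g ^ a = 1 :=
  PresentedGroup.one_of_mem (rels := metacyclicRels a b g)
    (x := FreeGroup.of MetacyclicGen.y ^ a) (by simp [metacyclicRels])

theorem semiconjBy_y (a b g : ℕ) : SemiconjBy (y a b g) (x a b g) (x a b g ^ g) := by
  have := PresentedGroup.one_of_mem (rels := metacyclicRels a b g)
    (x := FreeGroup.of MetacyclicGen.x ^ g * FreeGroup.of MetacyclicGen.y *
      (FreeGroup.of MetacyclicGen.y * FreeGroup.of MetacyclicGen.x)⁻¹) (by simp [metacyclicRels])
  exact (mul_inv_eq_one.1 this).symm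

/-- The homomorphism out of the metacyclic group given by images of `x` and `y`. -/
def lift {H : Type*} [Group H] {a b g : ℕ} (u v : H) (hu : u ^ b = 1) (hv : v ^ a = 1)
    (huv : u ^ g * v = v * u) : Metacyclic a b g →* H :=
  PresentedGroup.toGroup (f := fun s => match s with | .x => u | .y => v) (by
    rintro r (rfl | rfl | rfl)
    · simpa using hu
    · simpa using hv
    · simp [huv])

theorem lift_x {H : Type*} [Group H] {a b g : ℕ} (u v : H) (hu : u ^ b = 1) (hv : v ^ a = 1)
    (huv : u ^ g * v = v * u) : lift u v hu hv huv (x a b g) = u :=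
  PresentedGroup.toGroup.of _

theorem lift_y {H : Type*} [Group H] {a b g : ℕ} (u v : H) (hu : u ^ b = 1) (hv : v ^ a = 1)
    (huv : u ^ g * v = v * u) : lift u v hu hv huv (y a b g) = v :=
  PresentedGroup.toGroup.of _

theorem exists_eq_pow_mul_pow {a b g : ℕ} (ha : 0 < a) (hb : 0 < b) (u : Metacyclic a b g) :
    ∃ i j : ℕ, u = x a b g ^ i * y a b g ^ j := by
  have hx : ∀ (n : ℕ) (u : Metacyclic a b g), (∃ i j : ℕ, u = x a b g ^ i * y a b g ^ j) →
      ∃ i j : ℕ, x a b g ^ n * u = x a b g ^ i * y a b g ^ j := by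
    rintro n _ ⟨i, j, rfl⟩
    exact ⟨n + i, j, by rw [pow_add, mul_assoc]⟩
  have hy : ∀ (n : ℕ) (u : Metacyclic a b g), (∃ i j : ℕ, u = x a b g ^ i * y a b g ^ j) →
      ∃ i j : ℕ, y a b g ^ n * u = x a b g ^ i * y a b g ^ j := by
    rintro n u h
    induction n with
    | zero => simpa using h
    | succ n ih =>
      obtain ⟨i, j, hij⟩ := ih
      refine ⟨g * i, j + 1, ?_⟩
      rw [pow_succ', mul_assoc, hij, ← mul_assoc, ((semiconjBy_y a b g).pow_right i).eq, ← pow_mul,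
        mul_assoc, ← pow_succ']
  have hxinv : (x a b g)⁻¹ = x a b g ^ (b - 1) := by
    rw [inv_eq_iff_mul_eq_one, ← pow_succ', Nat.sub_add_cancel hb, x_pow]
  have hyinv : (y a b g)⁻¹ = y a b g ^ (a - 1) := by
    rw [inv_eq_iff_mul_eq_one, ← pow_succ', Nat.sub_add_cancel ha, y_pow]
  have hu : u ∈ Subgroup.closure (Set.range (PresentedGroup.of (rels := metacyclicRels a b g))) := by
    rw [PresentedGroup.closure_range_of]; trivial
  induction hu using Subgroup.closure_induction_left with
  | one => exact ⟨0, 0, by simp⟩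
  | mul_left s hs u _ ih =>
    obtain ⟨s | s, rfl⟩ := hs
    · exact (pow_one (x a b g)) ▸ hx 1 u ih
    · exact (pow_one (y a b g)) ▸ hy 1 u ih
  | inv_mul_cancel s hs u _ ih =>
    obtain ⟨s | s, rfl⟩ := hs
    · exact hxinv ▸ hx (b - 1) u ih
    · exact hyinv ▸ hy (a - 1) u ih

/-- The projection of `ℤ_p ⋉ ℤ_{p^{m+1}}` onto `ℤ_{p^m} ⊕ ℤ_p`. -/
def proj (p m g : ℕ) (hg : (p ^ m : ℤ) ∣ (g : ℤ) - 1) :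
    Metacyclic p (p ^ (m + 1)) g →* Multiplicative (ZMod (p ^ m) × ZMod (p ^ 1)) :=
  lift (Multiplicative.ofAdd (1, 0)) (Multiplicative.ofAdd (0, 1))
    (by
      rw [← ofAdd_nsmul, ← ofAdd_zero]
      congr 1
      simp [pow_succ])
    (by
      rw [← ofAdd_nsmul, ← ofAdd_zero]
      congr 1
      have : (p : ZMod (p ^ 1)) = 0 := by
        rw [ZMod.natCast_eq_zero_iff, pow_one]
      simp [this])
    (by
      rw [← ofAdd_nsmul, ← ofAdd_add, ← ofAdd_add]
      congr 1
      have h : (((g : ℤ) - 1 : ℤ) : ZMod (p ^ m)) = 0 :=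
        (ZMod.intCast_zmod_eq_zero_iff_dvd _ _).2 (by exact_mod_cast hg)
      have : (g : ZMod (p ^ m)) = 1 := by
        push_cast at h
        exact sub_eq_zero.1 h
      simp [this])

theorem proj_pow_mul_pow (hg : (p ^ m : ℤ) ∣ (g : ℤ) - 1) (i j : ℕ) :
    proj p m g hg (x p (p ^ (m + 1)) g ^ i * y p (p ^ (m + 1)) g ^ j) =
      Multiplicative.ofAdd ((i : ZMod (p ^ m)), (j : ZMod (p ^ 1))) := by
  rw [map_mul, map_pow, map_pow, proj, lift_x, lift_y, ← ofAdd_nsmul, ← ofAdd_nsmul, ← ofAdd_add]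
  simp

theorem exists_eq_pow_of_proj_eq_one (hp : 0 < p) (hg : (p ^ m : ℤ) ∣ (g : ℤ) - 1)
    (u : Metacyclic p (p ^ (m + 1)) g) (hu : proj p m g hg u = 1) :
    ∃ n : ℕ, u = (x p (p ^ (m + 1)) g ^ p ^ m) ^ n := by
  obtain ⟨i, j, rfl⟩ := exists_eq_pow_mul_pow hp (pow_pos hp _) u
  rw [proj_pow_mul_pow, ofAdd_eq_one, Prod.mk_eq_zero, ZMod.natCast_eq_zero_iff,
    ZMod.natCast_eq_zero_iff, pow_one] at hu
  obtain ⟨⟨n, rfl⟩, ⟨l, rfl⟩⟩ := hu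
  exact ⟨n, by rw [← pow_mul, pow_mul (y _ _ _), y_pow, one_pow, mul_one]⟩

/-- Conjugation by `y` raises this element to the power `g`, which fixes it: its order divides `p`,
and `g ≡ 1` mod `p` as `m ≥ 1`. -/
theorem x_pow_mem_center (hp : 0 < p) (hm : 1 ≤ m) (hg : (p ^ m : ℤ) ∣ (g : ℤ) - 1) :
    x p (p ^ (m + 1)) g ^ p ^ m ∈ Subgroup.center (Metacyclic p (p ^ (m + 1)) g) := by
  have hz : (x p (p ^ (m + 1)) g ^ p ^ m) ^ p = 1 := by
    rw [← pow_mul, ← pow_succ, x_pow]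
  have hgz : (x p (p ^ (m + 1)) g ^ p ^ m) ^ g = x p (p ^ (m + 1)) g ^ p ^ m := by
    conv_rhs => rw [← pow_one (x p (p ^ (m + 1)) g ^ p ^ m)]
    refine pow_eq_pow_iff_modEq.2 (Nat.ModEq.of_dvd (orderOf_dvd_of_pow_eq_one hz) ?_)
    refine ((Nat.modEq_iff_dvd).2 ?_).symm
    exact (dvd_pow_self (p : ℤ) (Nat.one_le_iff_ne_zero.1 hm)).trans hg
  have hy : Commute (y p (p ^ (m + 1)) g) (x p (p ^ (m + 1)) g ^ p ^ m) := by
    have := (semiconjBy_y p (p ^ (m + 1)) g).pow_right (p ^ m)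
    rwa [← pow_mul, mul_comm g, pow_mul, hgz] at this
  refine Subgroup.mem_center_iff.2 fun u => ?_
  obtain ⟨i, j, rfl⟩ := exists_eq_pow_mul_pow hp (pow_pos hp _) u
  exact ((((Commute.refl _).pow_right _).pow_left i).mul_left (hy.pow_left j)).eq

theorem proj_ker_le_center (hp : 0 < p) (hm : 1 ≤ m) (hg : (p ^ m : ℤ) ∣ (g : ℤ) - 1) :
    (proj p m g hg).ker ≤ Subgroup.center _ := by
  intro u hu
  obtain ⟨n, rfl⟩ := exists_eq_pow_of_proj_eq_one hp hg u hu
  exact Subgroup.pow_mem _ (x_pow_mem_center hp hm hg) n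

/-- The action of the metacyclic group on `ℤ_b` by affine maps. -/
noncomputable def affine {a b g : ℕ} (ha : a ≠ 0) (hg : (g : ZMod b) ^ a = 1) :
    Metacyclic a b g →* Equiv.Perm (ZMod b) :=
  lift (Equiv.addRight 1) (MulAction.toPermHom (ZMod b)ˣ (ZMod b) (Units.ofPowEqOne _ a hg ha))
    (by ext t; simp)
    (by rw [← map_pow, Units.pow_ofPowEqOne, map_one])
    (by ext t; simp [Units.smul_def])

theorem affine_x_pow {a b g : ℕ} (ha : a ≠ 0) (hg : (g : ZMod b) ^ a = 1) (n : ℕ) (t : ZMod b) :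
    affine ha hg (x a b g ^ n) t = t + n := by
  rw [map_pow, affine, lift_x]; simp

theorem affine_y {a b g : ℕ} (ha : a ≠ 0) (hg : (g : ZMod b) ^ a = 1) (t : ZMod b) :
    affine ha hg (y a b g) t = g * t := by
  rw [affine, lift_y]; simp [Units.smul_def]

/-- The affine action shows that the presentation does not collapse: `x ^ n` sends `0` to `n`. -/
theorem dvd_of_x_pow_eq_one {a b g : ℕ} (ha : a ≠ 0) (hg : (g : ZMod b) ^ a = 1) (n : ℕ)
    (h : x a b g ^ n = 1) : b ∣ n := by
  have := affine_x_pow ha hg n 0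
  rw [h, map_one, Equiv.Perm.one_apply, zero_add] at this
  exact (ZMod.natCast_eq_zero_iff _ _).1 this.symm

theorem y_mul_x_ne {a b g : ℕ} (ha : a ≠ 0) (hg : (g : ZMod b) ^ a = 1) (hg1 : (g : ZMod b) ≠ 1) :
    y a b g * x a b g ≠ x a b g * y a b g := by
  intro h
  have h1 := congrArg (fun u => affine ha hg u 0) h
  have hx := affine_x_pow ha hg 1
  rw [pow_one] at hx
  simp only [map_mul, Equiv.Perm.mul_apply, hx, affine_y] at h1
  exact hg1 (by simpa using h1)

/-! ### The extremal sequences and the two constants. -/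

/-- A product-one subsequence of `x, …, x, y, …, y` with `p - 1` terms `y` consists of a positive
multiple of `p^{m+1}` terms `x`. -/
theorem length_bounds_of_productOneSubseq (hp : p.Prime) (hgo : (g : ZMod (p ^ (m + 1))) ^ p = 1)
    (hg : (p ^ m : ℤ) ∣ (g : ℤ) - 1) (N : ℕ) (T : List (Metacyclic p (p ^ (m + 1)) g))
    (hT : IsProductOneSubseq T (List.replicate N (x p (p ^ (m + 1)) g) ++
      List.replicate (p - 1) (y p (p ^ (m + 1)) g))) :
    p ^ (m + 1) ≤ T.length ∧ T.length ≤ N := by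
  obtain ⟨hne, hsub, L, hperm, hprod⟩ := hT
  obtain ⟨T₁, T₂, rfl, h1, h2⟩ := List.sublist_append_iff.1 hsub
  obtain ⟨i, hi, rfl⟩ := List.sublist_replicate_iff.1 h1
  obtain ⟨j, hj, rfl⟩ := List.sublist_replicate_iff.1 h2
  have hφ : proj p m g hg (x p (p ^ (m + 1)) g ^ i * y p (p ^ (m + 1)) g ^ j) = 1 := by
    rw [← map_one (proj p m g hg), ← hprod, map_list_prod, (hperm.map _).prod_eq]
    simp
  rw [proj_pow_mul_pow, ofAdd_eq_one, Prod.mk_eq_zero, ZMod.natCast_eq_zero_iff (a := j),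
    pow_one] at hφ
  have hj0 : j = 0 := Nat.eq_zero_of_dvd_of_lt hφ.2 (by have := hp.pos; omega)
  subst hj0
  rw [List.replicate_zero, List.append_nil] at hperm hne ⊢
  rw [List.perm_replicate.1 hperm, List.prod_replicate] at hprod
  have := dvd_of_x_pow_eq_one hp.ne_zero hgo i hprod
  rw [List.length_replicate]
  refine ⟨Nat.le_of_dvd (Nat.pos_of_ne_zero ?_) this, hi⟩
  rintro rfl
  exact hne rfl

/-- Every sequence of length `p^{m+1} + p - 1` has a product-one subsequence of length at most
`p^{m+1}`. -/
theorem exists_short_productOneSubseq (hp : p.Prime) (hodd : Odd p) (hm : 1 ≤ m)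
    (hgo : orderOf (g : ZMod (p ^ (m + 1))) = p)
    (S : List (Metacyclic p (p ^ (m + 1)) g)) (hS : S.length = p ^ (m + 1) + p - 1) :
    ∃ T, IsProductOneSubseq T S ∧ T.length ≤ p ^ (m + 1) := by
  have := Fact.mk hp
  have hg := pow_dvd_sub_one_of_orderOf_eq hp hodd hgo
  have hpow : (g : ZMod (p ^ (m + 1))) ^ p = 1 := by
    rw [← orderOf_dvd_iff_pow_eq_one, hgo]
  have hg1 : (g : ZMod (p ^ (m + 1))) ≠ 1 := fun h => hp.one_lt.ne (by rw [← hgo, h, orderOf_one])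
  obtain ⟨L, hne, hle, hprod, hlen⟩ := exists_short_product_one
    (lt_of_le_of_ne hp.two_le fun h => absurd (h ▸ hodd) (by decide)) hm (proj p m g hg)
    (proj_ker_le_center hp.pos hm hg) ⟨_, _, y_mul_x_ne hp.ne_zero hpow hg1⟩
    (x p (p ^ (m + 1)) g ^ p ^ m) (by rw [← pow_mul, ← pow_succ, x_pow])
    (exists_eq_pow_of_proj_eq_one hp.pos hg) (S : Multiset _) (by simpa using hS)
  obtain ⟨T, hT, hTS⟩ := Multiset.coe_le.1 hle
  exact ⟨T, ⟨fun h => hne (by subst h; exact hT.symm.eq_nil), hTS, L, hT.symm, hprod⟩,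
    hT.length_eq ▸ hlen⟩

end Metacyclic

theorem proposition4p2 (p k g : ℕ) (hp : p.Prime) (hodd : Odd p) (hk : 1 < k)
    (hg : orderOf (g : ZMod (p ^ k)) = p) :
    davenport (Metacyclic p (p ^ k) g) = p ^ k + p - 1 ∧
      fConst (Metacyclic p (p ^ k) g) = p ^ k := by
  obtain ⟨m, rfl⟩ : ∃ m, k = m + 1 := ⟨k - 1, by omega⟩
  have hm : 1 ≤ m := by omega
  have hup := Metacyclic.exists_short_productOneSubseq hp hodd hm hg
  have hlow := Metacyclic.length_bounds_of_productOneSubseq hp (orderOf_dvd_iff_pow_eq_one.1 hg.dvd)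
    (pow_dvd_sub_one_of_orderOf_eq hp hodd hg)
  have hpos := hp.pos
  have hppos : 0 < p ^ (m + 1) := pow_pos hpos _
  have hd : davenport (Metacyclic p (p ^ (m + 1)) g) = p ^ (m + 1) + p - 1 := by
    refine IsLeast.csInf_eq ⟨⟨by omega, fun S hS => ?_⟩, ?_⟩
    · obtain ⟨T, hT, -⟩ := hup S hS
      exact ⟨T, hT⟩
    · rintro n ⟨-, hn⟩
      by_contra! hlt
      -- One `x` short of `p^k`, the sequence has no product-one subsequence; its prefixes rule out
      -- every smaller `n`.
      obtain ⟨T, hne, hsub, hone⟩ := hn ((List.replicate (p ^ (m + 1) - 1) (Metacyclic.x _ _ _) ++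
        List.replicate (p - 1) (Metacyclic.y _ _ _)).take n) (by simp; omega)
      have := hlow _ T ⟨hne, hsub.trans (List.take_sublist _ _), hone⟩
      omega
  refine ⟨hd, IsLeast.csInf_eq ⟨⟨hppos, fun S hS => hup S (hd ▸ hS)⟩, ?_⟩⟩
  rintro n ⟨-, hn⟩
  obtain ⟨T, hT, hlen⟩ := hn (List.replicate (p ^ (m + 1)) (Metacyclic.x _ _ _) ++
    List.replicate (p - 1) (Metacyclic.y _ _ _)) (by rw [hd]; simp; omega)
  exact (hlow _ T hT).1.trans hlen
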